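/- **Theorem (manifestation points with parameters).** *Language.* The librationist language £ has noemata $v_0,v_1,\dots$ (used as names and as bound variables). Terms are the noemata, two constants $\mathrm T$ and €, the terms $\downarrow ab$ ($a,b$ terms) and $\{u\mid A\}$ ($u$ a noema, $A$ a formula). Formulas are the atoms $ba$, also written $a\in b$, the formulas $\downarrow AB$ ("neither $A$ nor $B$") and $\forall yA$. The other connectives and $\exists$ are the usual abbreviations; $a=b$ is $\forall u(a\in u\to b\in u)$; $\{a,b\}=\{s\mid s=a\vee s=b\}$, $\langle a,b\rangle=\{\{a,a\},\{a,b\}\}$, and $\{\langle x,g\rangle\mid B\}=\{p\mid\exists x\exists g(p=\langle x,g\rangle\wedge B)\}$. A noema is present in an expression if it occurs free in it; a cognomen is a term in which no noema is present. $\mathbb TA$ is $\exists y(y\in\{y\mid A\})$ with $y$ the first noema not present in $A$. Expressions are identified with natural numbers through their binary spelling, and $\ulcorner n\urcorner$ is the numeral for $n$ in £: $\ulcorner 0\urcorner=\{v_0\mid v_0\ne v_0\}$, $\ulcorner n+1\urcorner=\{v_0\mid v_0\in\ulcorner n\urcorner\vee v_0=\ulcorner n\urcorner\}$. *Semantics.*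 Let $e_0,e_1,\dots$ be any sequence of cognomina. By recursion on the ordinal $\alpha$, the relation $\alpha\vDash A$ is given as follows for formulas $A$ in which no noema is present (all terms $a,b,c$ being cognomina). - $\alpha\vDash a\in\{u\mid A\}$ iff there is $\beta<\alpha$ with $\gamma\vDash A(a/u)$ for all $\gamma$ with $\beta\le\gamma<\alpha$; - $\alpha\vDash\,\downarrow AB$ iff $\alpha\nvDash A$ and $\alpha\nvDash B$; - $\alpha\vDash a\in\,\downarrow bc$ iff $\alpha\nvDash a\in b$ and $\alpha\nvDash a\in c$; - $\alpha\vDash\forall yA$ iff $\alpha\vDash A(a/y)$ for all cognomina $a$; - $\alpha\vDash a\in\mathrm T$ iff $\alpha\vDash a=\ulcorner A\urcorner$ and $\alpha\vDash\mathbb TA$ for some formula $A$; - $\alpha\vDash a\in$ € iff $\alpha\vDash a=\langle\ulcorner n\urcorner,b\rangle$ and $\alpha\vDash b=v_n$ for some $n$ and some cognomen $b$. At stage $\alpha$ the noema $v_n$ names $e_n$ if $\alpha\vDash v_m\neq e_n$ for all $m<n$, and otherwise names whatever $v_{n-1}$ names; a formula in which noemata are present is evaluated at stage $\alpha$ by putting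 for them the cognomina that they name at that stage. In the clauses for $\mathrm T$, € and the noemata, $\alpha\vDash a=b$ for cognomina is determined by the earlier stages: it says that $\alpha\vDash a\in c\Leftrightarrow\alpha\vDash b\in c$ for all cognomina $c$ of the form $\{u\mid A\}$ (and this agrees with the evaluation of the formula $a=b$). Let $\vDash_\gamma=\{A:\gamma\vDash\mathbb TA\}$, let $IN$ be the set of formulas that belong to $\vDash_\gamma$ for all sufficiently large $\gamma$, $OUT$ the set of those that belong to $\vDash_\gamma$ for no sufficiently large $\gamma$, and $UNSTAB$ the set of all other formulas. A limit ordinal $\kappa$ covers $\vDash$ if $IN\subseteq\,\vDash_\gamma\,\subseteq IN\cup UNSTAB$ for all $\gamma\ge\kappa$; it stabilizes $\vDash$ if moreover $\vDash_\kappa\,\subseteq IN$. Let Ϙ be the least ordinal that stabilizes $\vDash$. A formula $A$ is a *maxim* if Ϙ $\vDash\mathbb TA$. *Claim.* Let $x,y,z$ be distinct noemata and let $A=A(x,y,z)$ be a formula (other noemata may be present too, and $x,y,z$ need not all be present) such that every noema other than $x,y$ present in $A$ is substitutable (free) for $y$ in $A$. Then there is a term $h=h(z)$, the noemata present in which are exactly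 those present in $A$ other than $x$ and $y$, such that for every noema $w$ that is not present in $A$, is distinct from $y,z$, and is substitutable for $x$ in $A$, $$\forall w\,\forall z\,\bigl(w\in h(z)\leftrightarrow\mathbb T\mathbb TA(w,h(z),z)\bigr)$$ is a maxim (for every choice of the sequence $e$). Here $A(w,h(z),z)$ is $A$ with $w$ put for $x$ and $h(z)$ for $y$. Explicitly one may take, with new bound variables, $$d=\{\langle x,g\rangle\mid A(x,\{t\mid\langle t,g\rangle\in g\},z)\},\qquad h(z)=\{t\mid\langle t,d\rangle\in d\}.$$ -/

import Mathlib

namespace Libra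

/-! ### The language: terms and formulas

`Term.noema n` is the noema `v_n`, `alethizor` is `T`, `enumerator` is `€`, `Term.joint a b` is the
term `↓ab` and `Term.sort u A` is the term `{u | A}`.  `Formula.app b a` is the atomic formula `ba`,
also written `a ∈ b`; `Formula.joint A B` is the formula `↓AB` (neither `A` nor `B`). -/

mutual
inductive Term : Type
  | noema (n : ℕ) : Term
  | alethizor : Term
  | enumerator : Term
  | joint (a b : Term) : Term
  | sort (u : ℕ) (A : Formula) : Term
inductive Formula : Type
  | app (b a : Term) : Formula
  | joint (A B : Formula) : Formula
  | all (y : ℕ) (A : Formula) : Formula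
end

/-! The noemata present in an expression. -/
mutual
def Term.noemata : Term → Finset ℕ
  | .noema n => {n}
  | .alethizor => ∅
  | .enumerator => ∅
  | .joint a b => a.noemata ∪ b.noemata
  | .sort u A => A.noemata.erase u
def Formula.noemata : Formula → Finset ℕ
  | .app b a => b.noemata ∪ a.noemata
  | .joint A B => A.noemata ∪ B.noemata
  | .all y A => A.noemata.erase y
end

/-- A cognomen is a term in which no noema is present. -/
def Term.IsCognomen (a : Term) : Prop := a.noemata = ∅

/-! The substitution `(c/u)`, written `a.subst u c`; bound variables are not renamed. -/
mutual
def Term.subst : Term → ℕ → Term → Term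
  | .noema n, u, c => if u = n then c else .noema n
  | .alethizor, _, _ => .alethizor
  | .enumerator, _, _ => .enumerator
  | .joint a b, u, c => .joint (a.subst u c) (b.subst u c)
  | .sort y A, u, c => if u = y then .sort y A else .sort y (A.subst u c)
def Formula.subst : Formula → ℕ → Term → Formula
  | .app b a, u, c => .app (b.subst u c) (a.subst u c)
  | .joint A B, u, c => .joint (A.subst u c) (B.subst u c)
  | .all y A, u, c => if u = y then .all y A else .all y (A.subst u c)
end

/-! `a.Substitutable c u`: the term `c` is substitutable (free) for `u` in the expression `a`, that
is, no noema present in `c` becomes bound when `c` is put for `u`. -/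
mutual
def Term.Substitutable : Term → Term → ℕ → Prop
  | .noema _, _, _ => True
  | .alethizor, _, _ => True
  | .enumerator, _, _ => True
  | .joint a b, c, u => a.Substitutable c u ∧ b.Substitutable c u
  | .sort y A, c, u => u ∉ A.noemata.erase y ∨ (y ∉ c.noemata ∧ A.Substitutable c u)
def Formula.Substitutable : Formula → Term → ℕ → Prop
  | .app b a, c, u => b.Substitutable c u ∧ a.Substitutable c u
  | .joint A B, c, u => A.Substitutable c u ∧ B.Substitutable c u
  | .all y A, c, u => u ∉ A.noemata.erase y ∨ (y ∉ c.noemata ∧ A.Substitutable c u)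
end

/-! Simultaneous replacement of every noema `v_n` present in an expression by the term `ρ n`;
it is used with cognomina only. -/
mutual
def Term.inst : Term → (ℕ → Term) → Term
  | .noema n, ρ => ρ n
  | .alethizor, _ => .alethizor
  | .enumerator, _ => .enumerator
  | .joint a b, ρ => .joint (a.inst ρ) (b.inst ρ)
  | .sort y A, ρ => .sort y (A.inst (Function.update ρ y (.noema y)))
def Formula.inst : Formula → (ℕ → Term) → Formula
  | .app b a, ρ => .app (b.inst ρ) (a.inst ρ)
  | .joint A B, ρ => .joint (A.inst ρ) (B.inst ρ)
  | .all y A, ρ => .all y (A.inst (Function.update ρ y (.noema y)))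
end

/-! A number exceeding the index of every noema that occurs, free or bound, in an expression. -/
mutual
def Term.bound : Term → ℕ
  | .noema n => n + 1
  | .alethizor => 0
  | .enumerator => 0
  | .joint a b => max a.bound b.bound
  | .sort u A => max (u + 1) A.bound
def Formula.bound : Formula → ℕ
  | .app b a => max b.bound a.bound
  | .joint A B => max A.bound B.bound
  | .all y A => max (y + 1) A.bound
end

/-! ### Defined notions of the language -/

namespace Formula

/-- `a ∈ b`, that is `ba`. -/
def mem (a b : Term) : Formula := app b a
def neg (A : Formula) : Formula := joint A A
def or (A B : Formula) : Formula := joint (joint A B) (joint A B)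
def and (A B : Formula) : Formula := joint (joint A A) (joint B B)
def imp (A B : Formula) : Formula := joint (joint (joint A A) B) (joint (joint A A) B)
def iff (A B : Formula) : Formula := and (imp A B) (imp B A)
def ex (y : ℕ) (A : Formula) : Formula := neg (all y (neg A))

/-- The least index of a noema not present in `A`. -/
noncomputable def fresh (A : Formula) : ℕ := sInf {n : ℕ | n ∉ A.noemata}

/-- The defined truth operator `𝕋A`, that is `∃y (y ∈ {y | A})` for the first noema `y` not present
in `A`. -/
noncomputable def truth (A : Formula) : Formula :=
  ex A.fresh (mem (.noema A.fresh) (.sort A.fresh A))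

/-- Leibniz identity `a = b`, that is `∀r (a ∈ r → b ∈ r)`, with the bound variable `r` displayed;
`r` should not be present in `a`, `b`. -/
def eq (r : ℕ) (a b : Term) : Formula := all r (imp (mem a (.noema r)) (mem b (.noema r)))

end Formula

open Formula in
/-- `{a, b} = {s | s = a ∨ s = b}`, with the bound variables `s ≠ r` displayed; they should not be
present in `a`, `b`. -/
def Term.unorderedPair (s r : ℕ) (a b : Term) : Term :=
  .sort s (or (eq r (.noema s) a) (eq r (.noema s) b))

/-- The Kuratowski pair `⟨a, b⟩ = {{a}, {a, b}}`, with the bound variables `s ≠ r` displayed; they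
should not be present in `a`, `b`. -/
def Term.pair (s r : ℕ) (a b : Term) : Term :=
  .unorderedPair s r (.unorderedPair s r a a) (.unorderedPair s r a b)

/-! ### Expressions as numbers, and numerals -/

/-- Concatenation of numbers in binary notation. -/
def cat (m n : ℕ) : ℕ := m * 2 ^ Nat.size n + n

/-! The number that an expression is: the symbol `|_n`, a bar followed by `n` dots, is `2 ^ n`. -/
mutual
def Term.code : Term → ℕ
  | .noema n => 2 ^ (n + 5)
  | .alethizor => 2 ^ 3
  | .enumerator => 2 ^ 4
  | .joint a b => cat (cat (2 ^ 2) a.code) b.code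
  | .sort u A => cat (cat (2 ^ 0) (2 ^ (u + 5))) A.code
def Formula.code : Formula → ℕ
  | .app b a => cat b.code a.code
  | .joint A B => cat (cat (2 ^ 2) A.code) B.code
  | .all y A => cat (cat (2 ^ 1) (2 ^ (y + 5))) A.code
end

open Formula in
/-- The numerals: zero is `{v₀ | ¬ v₀ = v₀}`, and the successor of `n` is
`{v₀ | v₀ ∈ n ∨ v₀ = n}`. -/
def numeral : ℕ → Term
  | 0 => .sort 0 (neg (eq 1 (.noema 0) (.noema 0)))
  | n + 1 => .sort 0 (or (mem (.noema 0) (numeral n)) (eq 1 (.noema 0) (numeral n)))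

/-! ### The semantic process

In this part `P : Formula → Prop` stands for "holds at all stages from some earlier stage on", as
seen from the stage under consideration. -/

/-- Identity of cognomina at a stage: no sort `{u | A}` separates them.  See `holds_eq_iff`: this is
Leibniz identity `∀r (a ∈ r → b ∈ r)` as evaluated at the stage. -/
def Ident (P : Formula → Prop) (a b : Term) : Prop :=
  ∀ (u : ℕ) (A : Formula), A.noemata ⊆ {u} → (P (A.subst u a) ↔ P (A.subst u b))

open Classical in
/-- The cognomen named by the noema `v_n` at a stage, for an enumeration `e` of cognomina: it is
`e n` if `e n` is distinct, at the stage, from what `v_m` names for every `m < n`; otherwise it is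
what `v_(n-1)` names. -/
noncomputable def name (e : ℕ → Term) (P : Formula → Prop) : ℕ → Term
  | 0 => e 0
  | n + 1 =>
    if ∀ m, (_ : m < n + 1) → ¬ Ident P (name e P m) (e (n + 1)) then e (n + 1) else name e P n

/-- `a ∈ b` at a stage, for cognomina `a`, `b`.
* `a ∈ T` iff `a` is identical with the numeral of a formula `A` such that `𝕋A`;
* `a ∈ €` iff `a` is identical with `⟨n, b⟩` for a numeral `n` and some `b` identical with `v_n`;
* `a ∈ ↓bc` iff neither `a ∈ b` nor `a ∈ c`;
* `a ∈ {u | A}` iff `A(a/u)` holds at all stages from some earlier stage on.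

No noema is a cognomen, so the value on noemata is immaterial. -/
def Mem (e : ℕ → Term) (P : Formula → Prop) (a : Term) : Term → Prop
  | .noema _ => False
  | .alethizor => ∃ A : Formula, Ident P a (numeral A.code) ∧ P (A.inst (name e P))
  | .enumerator => ∃ (b : Term) (n : ℕ), b.IsCognomen ∧
      Ident P a (.pair 0 1 (numeral n) b) ∧ Ident P b (name e P n)
  | .joint b c => ¬ Mem e P a b ∧ ¬ Mem e P a c
  | .sort u A => P (A.subst u a)

/-- Logical depth of a formula (used to see that the next recursion ends). -/
def Formula.depth : Formula → ℕ
  | .app _ _ => 0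
  | .joint A B => max A.depth B.depth + 1
  | .all _ A => A.depth + 1

theorem Formula.depth_subst (u : ℕ) (c : Term) :
    ∀ A : Formula, (A.subst u c).depth = A.depth
  | .app _ _ => by simp [Formula.subst, Formula.depth]
  | .joint A B => by
      simp [Formula.subst, Formula.depth, Formula.depth_subst u c A, Formula.depth_subst u c B]
  | .all y A => by
      by_cases h : u = y
      · simp [Formula.subst, h]
      · simp [Formula.subst, Formula.depth, h, Formula.depth_subst u c A]

/-- Truth at a stage of a formula in which no noema is present. -/
def Holds (e : ℕ → Term) (P : Formula → Prop) : Formula → Prop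
  | .app b a => Mem e P a b
  | .joint A B => ¬ Holds e P A ∧ ¬ Holds e P B
  | .all y A => ∀ a : Term, a.IsCognomen → Holds e P (A.subst y a)
termination_by A => A.depth
decreasing_by
  all_goals simp only [Formula.depth, Formula.depth_subst]; omega

/-- The semantic process `α ⊨ A`.  Noemata stand for the cognomina which they name at stage `α`. -/
def Models (e : ℕ → Term) (α : Ordinal.{0}) (A : Formula) : Prop :=
  let P : Formula → Prop := fun B =>
    ∃ β, β < α ∧ ∀ γ, β ≤ γ → (_ : γ < α) → Models e γ B
  Holds e P (A.inst (name e P))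
termination_by α

/-! Stage-wise identity `Ident` is what the formula `a = b` expresses. -/

mutual
theorem Term.subst_of_notMem (u : ℕ) (c : Term) :
    ∀ a : Term, u ∉ a.noemata → a.subst u c = a
  | .noema n, h => by
      have : u ≠ n := by simpa [Term.noemata] using h
      simp [Term.subst, this]
  | .alethizor, _ => by simp [Term.subst]
  | .enumerator, _ => by simp [Term.subst]
  | .joint a b, h => by
      simp only [Term.noemata, Finset.mem_union, not_or] at h
      simp [Term.subst, Term.subst_of_notMem u c a h.1, Term.subst_of_notMem u c b h.2]
  | .sort y A, h => by
      by_cases hy : u = y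
      · simp [Term.subst, hy]
      · have : u ∉ A.noemata := by simpa [Term.noemata, hy] using h
        simp [Term.subst, hy, Formula.subst_of_notMem u c A this]
theorem Formula.subst_of_notMem (u : ℕ) (c : Term) :
    ∀ A : Formula, u ∉ A.noemata → A.subst u c = A
  | .app b a, h => by
      simp only [Formula.noemata, Finset.mem_union, not_or] at h
      simp [Formula.subst, Term.subst_of_notMem u c a h.2, Term.subst_of_notMem u c b h.1]
  | .joint A B, h => by
      simp only [Formula.noemata, Finset.mem_union, not_or] at h
      simp [Formula.subst, Formula.subst_of_notMem u c A h.1, Formula.subst_of_notMem u c B h.2]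
  | .all y A, h => by
      by_cases hy : u = y
      · simp [Formula.subst, hy]
      · have : u ∉ A.noemata := by simpa [Formula.noemata, hy] using h
        simp [Formula.subst, hy, Formula.subst_of_notMem u c A this]
end

theorem Ident.mem_iff {e : ℕ → Term} {P : Formula → Prop} {a b : Term} (h : Ident P a b) :
    ∀ c : Term, c.IsCognomen → (Mem e P a c ↔ Mem e P b c)
  | .noema _, _ => by simp [Mem]
  | .alethizor, _ => by
      simp only [Mem]
      exact exists_congr fun A => and_congr_left fun _ =>
        forall_congr' fun u => forall_congr' fun B => imp_congr_right fun hB => by rw [h u B hB]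
  | .enumerator, _ => by
      simp only [Mem]
      exact exists_congr fun d => exists_congr fun n => and_congr_right fun _ =>
        and_congr_left fun _ =>
          forall_congr' fun u => forall_congr' fun B => imp_congr_right fun hB => by rw [h u B hB]
  | .joint c d, hc => by
      simp only [Term.IsCognomen, Term.noemata, Finset.union_eq_empty] at hc
      simp only [Mem]
      rw [Ident.mem_iff h c hc.1, Ident.mem_iff h d hc.2]
  | .sort u A, hc => by
      simp only [Mem]
      refine h u A fun v hv => ?_
      simp only [Term.IsCognomen, Term.noemata] at hc
      by_contra hne
      have : v ∈ A.noemata.erase u := Finset.mem_erase.2 ⟨by simpa using hne, hv⟩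
      simp [hc] at this

theorem holds_eq_iff (e : ℕ → Term) (P : Formula → Prop) (r : ℕ) {a b : Term}
    (ha : a.IsCognomen) (hb : b.IsCognomen) : Holds e P (.eq r a b) ↔ Ident P a b := by
  have key : Holds e P (.eq r a b) ↔ ∀ c : Term, c.IsCognomen → Mem e P a c → Mem e P b c := by
    have ha' : ∀ c, a.subst r c = a := fun c =>
      Term.subst_of_notMem r c a (by rw [ha]; simp)
    have hb' : ∀ c, b.subst r c = b := fun c =>
      Term.subst_of_notMem r c b (by rw [hb]; simp)
    simp only [Formula.eq, Formula.imp, Formula.mem, Holds, Formula.subst, Term.subst, ha', hb',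
      if_true]
    refine forall_congr' fun c => imp_congr_right fun _ => ?_
    tauto
  rw [key]
  refine ⟨fun h u A hA => ?_, fun h c hc => (Ident.mem_iff h c hc).1⟩
  have hs : (Term.sort u A).IsCognomen := by
    simp only [Term.IsCognomen, Term.noemata]
    ext v
    simp only [Finset.mem_erase, Finset.notMem_empty, iff_false, not_and]
    exact fun hv hvA => hv (by simpa using hA hvA)
  have h1 := h (.sort u A) hs
  have h2 := h (.joint (.sort u A) (.sort u A)) (by
    simp only [Term.IsCognomen] at hs ⊢
    simp [Term.noemata] at hs ⊢
    exact hs)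
  simp only [Mem] at h1 h2
  tauto

/-! ### Stability, the closure ordinal, and maxims -/

/-- The formulas `A` with `γ ⊨ 𝕋A`. -/
def stageTruths (e : ℕ → Term) (γ : Ordinal.{0}) : Set Formula := {A | Models e γ A.truth}

def stablyIn (e : ℕ → Term) : Set Formula := {A | ∃ β, ∀ γ, β ≤ γ → A ∈ stageTruths e γ}

def stablyOut (e : ℕ → Term) : Set Formula := {A | ∃ β, ∀ γ, β ≤ γ → A ∉ stageTruths e γ}

def unstable (e : ℕ → Term) : Set Formula := (stablyIn e ∪ stablyOut e)ᶜ

def Covers (e : ℕ → Term) (κ : Ordinal.{0}) : Prop :=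
  Order.IsSuccLimit κ ∧ ∀ γ, κ ≤ γ →
    stablyIn e ⊆ stageTruths e γ ∧ stageTruths e γ ⊆ stablyIn e ∪ unstable e

def Stabilizes (e : ℕ → Term) (σ : Ordinal.{0}) : Prop :=
  Covers e σ ∧ stageTruths e σ ⊆ stablyIn e

/-- The closure ordinal: the least stabilizing ordinal. -/
noncomputable def koppa (e : ℕ → Term) : Ordinal.{0} := sInf {σ | Stabilizes e σ}

/-- `A` is a maxim: `𝕋A` holds at the closure ordinal. -/
def IsMaxim (e : ℕ → Term) (A : Formula) : Prop := Models e (koppa e) A.truth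

/-! ### Manifestation points -/

open Formula in
/-- The term `{t | ⟨t, d⟩ ∈ d}` where `d = {⟨x, g⟩ | A(x, {t | ⟨t, g⟩ ∈ g})}` and the second argument
is put for `y`; here `{⟨x, g⟩ | B}` is `{p | ∃x ∃g (p = ⟨x, g⟩ ∧ B)}`.  The bound variables
`t, p, g, s, r` introduced are new. -/
def manifestationPoint (x y : ℕ) (A : Formula) : Term :=
  let N := max A.bound (max (x + 1) (y + 1))
  let t := N
  let p := N + 1
  let g := N + 2
  let s := N + 3
  let r := N + 4
  let selfApp : Term → Term := fun c => .sort t (mem (.pair s r (.noema t) c) c)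
  let d : Term := .sort p (ex x (ex g
    (and (eq r (.noema p) (.pair s r (.noema x) (.noema g)))
      (A.subst y (selfApp (.noema g))))))
  selfApp d

end Libra

/-!
The proof shows that the biconditional `w ∈ h ↔ 𝕋𝕋A(w, h, z)` holds at every sufficiently late
stage, for all values of the noemata, so that it is stably in. The closure ordinal covers, hence
everything stably in is settled there, and the biconditional is a maxim. This last step needs that a
stabilizing ordinal exists at all (`exists_stabilizes`), which is a closing-off argument of length
`ω` based on there being only a set of formulas.

Membership in `h = {t | ⟨t, d⟩ ∈ d}` at a stage says that at all stages just below, membership of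
`⟨w, d⟩` in `d` holds, which in turn says that the condition
`∃x ∃g (⟨w, d⟩ = ⟨x, g⟩ ∧ A(x, {t | ⟨t, g⟩ ∈ g}))` holds at all stages just below those. These two
passages to earlier stages are the ones made by the two operators `𝕋`, so it remains to see that at
late stages the condition is equivalent to `A(w, h)`.

For this, identity has to permit substitution at the very stage at which it is evaluated. At an
arbitrary stage it does not: identity at a stage is indiscernibility at the stages before.
However, identity can only be lost as the stages increase (`Ident.of_le`), so that from some stage
on it agrees with identity at every stage (`exists_identFinal`). Cognomina identical at the next
stage are indiscernible at the present one (`AlwaysIdent.holds_iff`); this gives substitutivity, the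
injectivity of Kuratowski pairs (`IdentFinal.pair_injective`), and with them the equivalence
(`IdentFinal.models_exists_eq_pair`, `IdentFinal.holds_mem_manifestationPoint`).

Formulas are evaluated throughout under valuations, using `Term.inst` and `Formula.inst`; the first
part relates these to substitution.
-/

namespace Libra

/-! ### Substitution and instantiation -/

/-- An assignment of cognomina to the noemata. -/
def IsValuation (ρ : ℕ → Term) : Prop := ∀ n, (ρ n).IsCognomen

/-- An assignment that puts cognomina for some of the noemata and leaves the others as they are;
such assignments arise when `Term.inst` passes a binder. -/
def IsPartialValuation (ρ : ℕ → Term) : Prop := ∀ n, (ρ n).IsCognomen ∨ ρ n = .noema n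

theorem IsValuation.isPartialValuation {ρ : ℕ → Term} (h : IsValuation ρ) :
    IsPartialValuation ρ := fun n => Or.inl (h n)

theorem IsValuation.update {ρ : ℕ → Term} (h : IsValuation ρ) (u : ℕ) {a : Term}
    (ha : a.IsCognomen) : IsValuation (Function.update ρ u a) := by
  intro n
  by_cases hn : n = u
  · subst hn; simpa using ha
  · simpa [hn] using h n

theorem IsPartialValuation.update {ρ : ℕ → Term} (h : IsPartialValuation ρ) (u : ℕ) :
    IsPartialValuation (Function.update ρ u (.noema u)) := by
  intro n
  by_cases hn : n = u
  · subst hn; simp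
  · simpa [hn] using h n

mutual
theorem Term.inst_congr : ∀ (a : Term) {ρ σ : ℕ → Term}, (∀ n ∈ a.noemata, ρ n = σ n) →
    a.inst ρ = a.inst σ
  | .noema n, _, _, h => h n (by simp [Term.noemata])
  | .alethizor, _, _, _ => rfl
  | .enumerator, _, _, _ => rfl
  | .joint a b, _, _, h => by
      simp only [Term.noemata, Finset.mem_union] at h
      simp only [Term.inst]
      rw [Term.inst_congr a fun n hn => h n (Or.inl hn),
        Term.inst_congr b fun n hn => h n (Or.inr hn)]
  | .sort y A, _, _, h => by
      simp only [Term.inst]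
      rw [Formula.inst_congr A fun n hn => ?_]
      by_cases hy : n = y
      · simp [hy]
      · simpa [hy] using h n (by simp [Term.noemata, hy, hn])
theorem Formula.inst_congr : ∀ (A : Formula) {ρ σ : ℕ → Term}, (∀ n ∈ A.noemata, ρ n = σ n) →
    A.inst ρ = A.inst σ
  | .app b a, _, _, h => by
      simp only [Formula.noemata, Finset.mem_union] at h
      simp only [Formula.inst]
      rw [Term.inst_congr a fun n hn => h n (Or.inr hn),
        Term.inst_congr b fun n hn => h n (Or.inl hn)]
  | .joint A B, _, _, h => by
      simp only [Formula.noemata, Finset.mem_union] at h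
      simp only [Formula.inst]
      rw [Formula.inst_congr A fun n hn => h n (Or.inl hn),
        Formula.inst_congr B fun n hn => h n (Or.inr hn)]
  | .all y A, _, _, h => by
      simp only [Formula.inst]
      rw [Formula.inst_congr A fun n hn => ?_]
      by_cases hy : n = y
      · simp [hy]
      · simpa [hy] using h n (by simp [Formula.noemata, hy, hn])
end

mutual
theorem Term.inst_noema : ∀ a : Term, a.inst .noema = a
  | .noema n => rfl
  | .alethizor => rfl
  | .enumerator => rfl
  | .joint a b => by simp only [Term.inst]; rw [Term.inst_noema a, Term.inst_noema b]
  | .sort y A => by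
      simp only [Term.inst]; rw [Function.update_eq_self y Term.noema, Formula.inst_noema A]
theorem Formula.inst_noema : ∀ A : Formula, A.inst .noema = A
  | .app b a => by simp only [Formula.inst]; rw [Term.inst_noema a, Term.inst_noema b]
  | .joint A B => by simp only [Formula.inst]; rw [Formula.inst_noema A, Formula.inst_noema B]
  | .all y A => by
      simp only [Formula.inst]; rw [Function.update_eq_self y Term.noema, Formula.inst_noema A]
end

theorem Term.IsCognomen.inst_eq {a : Term} (h : a.IsCognomen) (ρ : ℕ → Term) : a.inst ρ = a := by
  rw [Term.inst_congr a (σ := .noema) (by simp [show a.noemata = ∅ from h]), Term.inst_noema]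

theorem Formula.inst_eq_self {A : Formula} (h : A.noemata = ∅) (ρ : ℕ → Term) : A.inst ρ = A := by
  rw [Formula.inst_congr A (σ := .noema) (by simp [h]), Formula.inst_noema]

theorem Formula.inst_update_of_notMem {A : Formula} {u : ℕ} (h : u ∉ A.noemata) (ρ : ℕ → Term)
    (a : Term) : A.inst (Function.update ρ u a) = A.inst ρ :=
  A.inst_congr fun n hn => by rw [Function.update_of_ne (by rintro rfl; exact h hn)]

theorem Term.inst_update_of_notMem {c : Term} {u : ℕ} (h : u ∉ c.noemata) (ρ : ℕ → Term)
    (a : Term) : c.inst (Function.update ρ u a) = c.inst ρ :=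
  c.inst_congr fun n hn => by rw [Function.update_of_ne (by rintro rfl; exact h hn)]

/-! The only noemata present after a partial valuation is applied are those which it leaves. -/
mutual
theorem Term.of_mem_noemata_inst : ∀ (a : Term) {ρ : ℕ → Term}, IsPartialValuation ρ →
    ∀ n ∈ (a.inst ρ).noemata, n ∈ a.noemata ∧ ρ n = .noema n
  | .noema m, ρ, h, n, hn => by
      simp only [Term.inst] at hn
      rcases h m with hm | hm
      · simp [show (ρ m).noemata = ∅ from hm] at hn
      · rw [hm] at hn
        simp only [Term.noemata, Finset.mem_singleton] at hn
        subst hn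
        simp [Term.noemata, hm]
  | .alethizor, _, _, n, hn => by simp [Term.inst, Term.noemata] at hn
  | .enumerator, _, _, n, hn => by simp [Term.inst, Term.noemata] at hn
  | .joint a b, _, h, n, hn => by
      simp only [Term.inst, Term.noemata, Finset.mem_union] at hn ⊢
      rcases hn with hn | hn
      · exact ⟨Or.inl (Term.of_mem_noemata_inst a h n hn).1, (Term.of_mem_noemata_inst a h n hn).2⟩
      · exact ⟨Or.inr (Term.of_mem_noemata_inst b h n hn).1, (Term.of_mem_noemata_inst b h n hn).2⟩
  | .sort y A, _, h, n, hn => by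
      simp only [Term.inst, Term.noemata, Finset.mem_erase] at hn ⊢
      have := Formula.of_mem_noemata_inst A (h.update y) n hn.2
      exact ⟨⟨hn.1, this.1⟩, by simpa [hn.1] using this.2⟩
theorem Formula.of_mem_noemata_inst : ∀ (A : Formula) {ρ : ℕ → Term}, IsPartialValuation ρ →
    ∀ n ∈ (A.inst ρ).noemata, n ∈ A.noemata ∧ ρ n = .noema n
  | .app b a, _, h, n, hn => by
      simp only [Formula.inst, Formula.noemata, Finset.mem_union] at hn ⊢
      rcases hn with hn | hn
      · exact ⟨Or.inl (Term.of_mem_noemata_inst b h n hn).1, (Term.of_mem_noemata_inst b h n hn).2⟩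
      · exact ⟨Or.inr (Term.of_mem_noemata_inst a h n hn).1, (Term.of_mem_noemata_inst a h n hn).2⟩
  | .joint A B, _, h, n, hn => by
      simp only [Formula.inst, Formula.noemata, Finset.mem_union] at hn ⊢
      rcases hn with hn | hn
      · exact ⟨Or.inl (Formula.of_mem_noemata_inst A h n hn).1,
          (Formula.of_mem_noemata_inst A h n hn).2⟩
      · exact ⟨Or.inr (Formula.of_mem_noemata_inst B h n hn).1,
          (Formula.of_mem_noemata_inst B h n hn).2⟩
  | .all y A, _, h, n, hn => by
      simp only [Formula.inst, Formula.noemata, Finset.mem_erase] at hn ⊢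
      have := Formula.of_mem_noemata_inst A (h.update y) n hn.2
      exact ⟨⟨hn.1, this.1⟩, by simpa [hn.1] using this.2⟩
end

theorem Term.isCognomen_inst (a : Term) {ρ : ℕ → Term} (h : IsValuation ρ) :
    (a.inst ρ).IsCognomen := by
  refine Finset.eq_empty_of_forall_notMem fun n hn => ?_
  have h1 := (a.of_mem_noemata_inst h.isPartialValuation n hn).2
  have h2 := h n
  rw [h1] at h2
  simp [Term.IsCognomen, Term.noemata] at h2

theorem Formula.noemata_inst (A : Formula) {ρ : ℕ → Term} (h : IsValuation ρ) :
    (A.inst ρ).noemata = ∅ := by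
  refine Finset.eq_empty_of_forall_notMem fun n hn => ?_
  have h1 := (A.of_mem_noemata_inst h.isPartialValuation n hn).2
  have h2 := h n
  rw [h1] at h2
  simp [Term.IsCognomen, Term.noemata] at h2

mutual
theorem Term.subst_inst (y : ℕ) (c : Term) : ∀ (a : Term) {ρ : ℕ → Term}, IsPartialValuation ρ →
    ρ y = .noema y → (a.inst ρ).subst y c = a.inst (Function.update ρ y c)
  | .noema n, ρ, h, hy => by
      simp only [Term.inst]
      by_cases hn : n = y
      · subst hn; simp [hy, Term.subst]
      · rw [Function.update_of_ne hn]
        apply Term.subst_of_notMem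
        rcases h n with h | h
        · simp [show (ρ n).noemata = ∅ from h]
        · simp [h, Term.noemata, Ne.symm hn]
  | .alethizor, _, _, _ => by simp [Term.inst, Term.subst]
  | .enumerator, _, _, _ => by simp [Term.inst, Term.subst]
  | .joint a b, _, h, hy => by
      simp only [Term.inst, Term.subst]
      rw [Term.subst_inst y c a h hy, Term.subst_inst y c b h hy]
  | .sort z A, ρ, h, hy => by
      simp only [Term.inst, Term.subst]
      by_cases hz : y = z
      · subst hz; simp
      · rw [if_neg hz, Formula.subst_inst y c A (h.update z) (by simp [hz, hy]),
          Function.update_comm hz]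
theorem Formula.subst_inst (y : ℕ) (c : Term) : ∀ (A : Formula) {ρ : ℕ → Term},
    IsPartialValuation ρ → ρ y = .noema y → (A.inst ρ).subst y c = A.inst (Function.update ρ y c)
  | .app b a, _, h, hy => by
      simp only [Formula.inst, Formula.subst]
      rw [Term.subst_inst y c a h hy, Term.subst_inst y c b h hy]
  | .joint A B, _, h, hy => by
      simp only [Formula.inst, Formula.subst]
      rw [Formula.subst_inst y c A h hy, Formula.subst_inst y c B h hy]
  | .all z A, ρ, h, hy => by
      simp only [Formula.inst, Formula.subst]
      by_cases hz : y = z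
      · subst hz; simp
      · rw [if_neg hz, Formula.subst_inst y c A (h.update z) (by simp [hz, hy]),
          Function.update_comm hz]
end

/-- Instantiation past a binder, followed by substitution for the bound noema, is instantiation
with the updated assignment. -/
theorem Formula.subst_inst_update (A : Formula) {ρ : ℕ → Term} (h : IsPartialValuation ρ) (y : ℕ)
    (c : Term) : (A.inst (Function.update ρ y (.noema y))).subst y c =
      A.inst (Function.update ρ y c) := by
  rw [A.subst_inst y c (h.update y) (by simp)]
  simp

/-! A capture-free substitution followed by instantiation is one instantiation. -/
mutual
theorem Term.inst_subst (u : ℕ) (c : Term) : ∀ (a : Term), a.Substitutable c u → ∀ ρ : ℕ → Term,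
    (a.subst u c).inst ρ = a.inst (Function.update ρ u (c.inst ρ))
  | .noema n, _, ρ => by
      by_cases hn : u = n
      · subst hn; simp [Term.subst, Term.inst]
      · simp [Term.subst, Term.inst, hn, Ne.symm hn]
  | .alethizor, _, _ => by simp [Term.inst, Term.subst]
  | .enumerator, _, _ => by simp [Term.inst, Term.subst]
  | .joint a b, h, ρ => by
      simp only [Term.Substitutable] at h
      simp only [Term.inst, Term.subst]
      rw [Term.inst_subst u c a h.1, Term.inst_subst u c b h.2]
  | .sort y A, h, ρ => by
      simp only [Term.Substitutable] at h
      by_cases hu : u ∈ (Term.sort y A).noemata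
      · have hy : u ≠ y := (Finset.mem_erase.1 hu).1
        obtain ⟨h1, h2⟩ := h.resolve_left (not_not.2 hu)
        simp only [Term.inst, Term.subst, if_neg hy]
        rw [Formula.inst_subst u c A h2, Term.inst_update_of_notMem h1, Function.update_comm hy]
      · rw [Term.subst_of_notMem u c _ hu, Term.inst_update_of_notMem hu]
theorem Formula.inst_subst (u : ℕ) (c : Term) : ∀ (A : Formula), A.Substitutable c u →
    ∀ ρ : ℕ → Term, (A.subst u c).inst ρ = A.inst (Function.update ρ u (c.inst ρ))
  | .app b a, h, ρ => by
      simp only [Formula.Substitutable] at h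
      simp only [Formula.inst, Formula.subst]
      rw [Term.inst_subst u c a h.2, Term.inst_subst u c b h.1]
  | .joint A B, h, ρ => by
      simp only [Formula.Substitutable] at h
      simp only [Formula.inst, Formula.subst]
      rw [Formula.inst_subst u c A h.1, Formula.inst_subst u c B h.2]
  | .all y A, h, ρ => by
      simp only [Formula.Substitutable] at h
      by_cases hu : u ∈ (Formula.all y A).noemata
      · have hy : u ≠ y := (Finset.mem_erase.1 hu).1
        obtain ⟨h1, h2⟩ := h.resolve_left (not_not.2 hu)
        simp only [Formula.inst, Formula.subst, if_neg hy]
        rw [Formula.inst_subst u c A h2, Term.inst_update_of_notMem h1, Function.update_comm hy]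
      · rw [Formula.subst_of_notMem u c _ hu, Formula.inst_update_of_notMem hu]
end

mutual
theorem Term.noemata_subst_subset (u : ℕ) (c : Term) : ∀ a : Term,
    (a.subst u c).noemata ⊆ a.noemata.erase u ∪ c.noemata
  | .noema n => by
      intro v
      by_cases hn : u = n
      · subst hn; simp +contextual [Term.subst]
      · simp only [Term.subst, hn, if_false, Term.noemata]; grind
  | .alethizor => by simp [Term.subst, Term.noemata]
  | .enumerator => by simp [Term.subst, Term.noemata]
  | .joint a b => by
      have h1 := Term.noemata_subst_subset u c a
      have h2 := Term.noemata_subst_subset u c b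
      simp only [Term.subst, Term.noemata]
      grind
  | .sort y A => by
      have h1 := Formula.noemata_subst_subset u c A
      simp only [Term.subst]
      split_ifs <;> simp only [Term.noemata] <;> grind
theorem Formula.noemata_subst_subset (u : ℕ) (c : Term) : ∀ A : Formula,
    (A.subst u c).noemata ⊆ A.noemata.erase u ∪ c.noemata
  | .app b a => by
      have h1 := Term.noemata_subst_subset u c a
      have h2 := Term.noemata_subst_subset u c b
      simp only [Formula.subst, Formula.noemata]
      grind
  | .joint A B => by
      have h1 := Formula.noemata_subst_subset u c A
      have h2 := Formula.noemata_subst_subset u c B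
      simp only [Formula.subst, Formula.noemata]
      grind
  | .all y A => by
      have h1 := Formula.noemata_subst_subset u c A
      simp only [Formula.subst]
      split_ifs <;> simp only [Formula.noemata] <;> grind
end

mutual
theorem Term.erase_noemata_subset_subst (u : ℕ) (c : Term) : ∀ a : Term,
    a.noemata.erase u ⊆ (a.subst u c).noemata
  | .noema n => by
      intro v
      by_cases hn : u = n
      · subst hn; simp [Term.noemata]
      · simp [Term.subst, hn]
  | .alethizor => by simp [Term.noemata]
  | .enumerator => by simp [Term.noemata]
  | .joint a b => by
      have h1 := Term.erase_noemata_subset_subst u c a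
      have h2 := Term.erase_noemata_subset_subst u c b
      simp only [Term.subst, Term.noemata]
      grind
  | .sort y A => by
      have h1 := Formula.erase_noemata_subset_subst u c A
      simp only [Term.subst]
      split_ifs <;> simp only [Term.noemata] <;> grind
theorem Formula.erase_noemata_subset_subst (u : ℕ) (c : Term) : ∀ A : Formula,
    A.noemata.erase u ⊆ (A.subst u c).noemata
  | .app b a => by
      have h1 := Term.erase_noemata_subset_subst u c a
      have h2 := Term.erase_noemata_subset_subst u c b
      simp only [Formula.subst, Formula.noemata]
      grind
  | .joint A B => by
      have h1 := Formula.erase_noemata_subset_subst u c A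
      have h2 := Formula.erase_noemata_subset_subst u c B
      simp only [Formula.subst, Formula.noemata]
      grind
  | .all y A => by
      have h1 := Formula.erase_noemata_subset_subst u c A
      simp only [Formula.subst]
      split_ifs <;> simp only [Formula.noemata] <;> grind
end

mutual
theorem Term.noemata_lt_bound : ∀ a : Term, ∀ n ∈ a.noemata, n < a.bound
  | .noema n, m, h => by simp [Term.noemata, Term.bound] at h ⊢; omega
  | .alethizor, m, h => by simp [Term.noemata] at h
  | .enumerator, m, h => by simp [Term.noemata] at h
  | .joint a b, m, h => by
      simp only [Term.noemata, Finset.mem_union, Term.bound, lt_max_iff] at h ⊢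
      exact h.imp (Term.noemata_lt_bound a m) (Term.noemata_lt_bound b m)
  | .sort y A, m, h => by
      simp only [Term.noemata, Finset.mem_erase, Term.bound, lt_max_iff] at h ⊢
      exact Or.inr (Formula.noemata_lt_bound A m h.2)
theorem Formula.noemata_lt_bound : ∀ A : Formula, ∀ n ∈ A.noemata, n < A.bound
  | .app b a, m, h => by
      simp only [Formula.noemata, Finset.mem_union, Formula.bound, lt_max_iff] at h ⊢
      exact h.imp (Term.noemata_lt_bound b m) (Term.noemata_lt_bound a m)
  | .joint A B, m, h => by
      simp only [Formula.noemata, Finset.mem_union, Formula.bound, lt_max_iff] at h ⊢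
      exact h.imp (Formula.noemata_lt_bound A m) (Formula.noemata_lt_bound B m)
  | .all y A, m, h => by
      simp only [Formula.noemata, Finset.mem_erase, Formula.bound, lt_max_iff] at h ⊢
      exact Or.inr (Formula.noemata_lt_bound A m h.2)
end

mutual
theorem Term.substitutable_of_bound_le (u : ℕ) (c : Term) : ∀ a : Term,
    (∀ n ∈ c.noemata, a.bound ≤ n) → a.Substitutable c u
  | .noema n, h => by simp [Term.Substitutable]
  | .alethizor, h => by simp [Term.Substitutable]
  | .enumerator, h => by simp [Term.Substitutable]
  | .joint a b, h => by
      simp only [Term.bound, max_le_iff] at h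
      exact ⟨Term.substitutable_of_bound_le u c a fun n hn => (h n hn).1,
        Term.substitutable_of_bound_le u c b fun n hn => (h n hn).2⟩
  | .sort y A, h => by
      simp only [Term.bound, max_le_iff] at h
      exact Or.inr ⟨fun hy => by have := (h y hy).1; omega,
        Formula.substitutable_of_bound_le u c A fun n hn => (h n hn).2⟩
theorem Formula.substitutable_of_bound_le (u : ℕ) (c : Term) : ∀ A : Formula,
    (∀ n ∈ c.noemata, A.bound ≤ n) → A.Substitutable c u
  | .app b a, h => by
      simp only [Formula.bound, max_le_iff] at h
      exact ⟨Term.substitutable_of_bound_le u c b fun n hn => (h n hn).1,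
        Term.substitutable_of_bound_le u c a fun n hn => (h n hn).2⟩
  | .joint A B, h => by
      simp only [Formula.bound, max_le_iff] at h
      exact ⟨Formula.substitutable_of_bound_le u c A fun n hn => (h n hn).1,
        Formula.substitutable_of_bound_le u c B fun n hn => (h n hn).2⟩
  | .all y A, h => by
      simp only [Formula.bound, max_le_iff] at h
      exact Or.inr ⟨fun hy => by have := (h y hy).1; omega,
        Formula.substitutable_of_bound_le u c A fun n hn => (h n hn).2⟩
end

mutual
theorem Term.substitutable_of_forall_noema (u : ℕ) (c : Term) : ∀ a : Term,
    (∀ v ∈ c.noemata, a.Substitutable (.noema v) u) → a.Substitutable c u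
  | .noema n, h => by simp [Term.Substitutable]
  | .alethizor, h => by simp [Term.Substitutable]
  | .enumerator, h => by simp [Term.Substitutable]
  | .joint a b, h => by
      simp only [Term.Substitutable] at h ⊢
      exact ⟨Term.substitutable_of_forall_noema u c a fun n hn => (h n hn).1,
        Term.substitutable_of_forall_noema u c b fun n hn => (h n hn).2⟩
  | .sort y A, h => by
      simp only [Term.Substitutable, Term.noemata, Finset.mem_singleton] at h ⊢
      refine or_iff_not_imp_left.2 fun hu => ⟨fun hy => ?_, ?_⟩
      · exact ((h y hy).resolve_left hu).1 rfl
      · exact Formula.substitutable_of_forall_noema u c A fun n hn => ((h n hn).resolve_left hu).2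
theorem Formula.substitutable_of_forall_noema (u : ℕ) (c : Term) : ∀ A : Formula,
    (∀ v ∈ c.noemata, A.Substitutable (.noema v) u) → A.Substitutable c u
  | .app b a, h => by
      simp only [Formula.Substitutable] at h ⊢
      exact ⟨Term.substitutable_of_forall_noema u c b fun n hn => (h n hn).1,
        Term.substitutable_of_forall_noema u c a fun n hn => (h n hn).2⟩
  | .joint A B, h => by
      simp only [Formula.Substitutable] at h ⊢
      exact ⟨Formula.substitutable_of_forall_noema u c A fun n hn => (h n hn).1,
        Formula.substitutable_of_forall_noema u c B fun n hn => (h n hn).2⟩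
  | .all y A, h => by
      simp only [Formula.Substitutable, Term.noemata, Finset.mem_singleton] at h ⊢
      refine or_iff_not_imp_left.2 fun hu => ⟨fun hy => ?_, ?_⟩
      · exact ((h y hy).resolve_left hu).1 rfl
      · exact Formula.substitutable_of_forall_noema u c A fun n hn => ((h n hn).resolve_left hu).2
end

mutual
theorem Term.Substitutable.subst {u x w : ℕ} {c : Term} (hw : w ≠ u) : ∀ a : Term,
    a.Substitutable c u → (a.subst x (.noema w)).Substitutable c u
  | .noema n, _ => by simp only [Term.subst]; split_ifs <;> simp [Term.Substitutable]
  | .alethizor, _ => by simp [Term.subst, Term.Substitutable]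
  | .enumerator, _ => by simp [Term.subst, Term.Substitutable]
  | .joint a b, h => by
      simp only [Term.Substitutable, Term.subst] at h ⊢
      exact ⟨Term.Substitutable.subst hw a h.1, Term.Substitutable.subst hw b h.2⟩
  | .sort y A, h => by
      simp only [Term.subst]
      split_ifs with hx
      · exact h
      · simp only [Term.Substitutable] at h ⊢
        refine h.imp (fun h1 h2 => h1 ?_) (And.imp_right (Formula.Substitutable.subst hw A))
        have := Formula.noemata_subst_subset x (.noema w) A (Finset.mem_erase.1 h2).2
        simp only [Term.noemata] at this
        grind
theorem Formula.Substitutable.subst {u x w : ℕ} {c : Term} (hw : w ≠ u) : ∀ A : Formula,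
    A.Substitutable c u → (A.subst x (.noema w)).Substitutable c u
  | .app b a, h => by
      simp only [Formula.Substitutable, Formula.subst] at h ⊢
      exact ⟨Term.Substitutable.subst hw b h.1, Term.Substitutable.subst hw a h.2⟩
  | .joint A B, h => by
      simp only [Formula.Substitutable, Formula.subst] at h ⊢
      exact ⟨Formula.Substitutable.subst hw A h.1, Formula.Substitutable.subst hw B h.2⟩
  | .all y A, h => by
      simp only [Formula.subst]
      split_ifs with hx
      · exact h
      · simp only [Formula.Substitutable] at h ⊢
        refine h.imp (fun h1 h2 => h1 ?_) (And.imp_right (Formula.Substitutable.subst hw A))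
        have := Formula.noemata_subst_subset x (.noema w) A (Finset.mem_erase.1 h2).2
        simp only [Term.noemata] at this
        grind
end

theorem Formula.fresh_notMem (A : Formula) : A.fresh ∉ A.noemata :=
  Nat.sInf_mem (s := {n : ℕ | n ∉ A.noemata}) (Infinite.exists_notMem_finset A.noemata)

/-! ### Truth of instantiated formulas -/

section Holds

variable {e : ℕ → Term} {P : Formula → Prop}

theorem Ident.refl (P : Formula → Prop) (a : Term) : Ident P a a := fun _ _ _ => Iff.rfl

theorem Ident.symm {a b : Term} (h : Ident P a b) : Ident P b a := fun u A hA => (h u A hA).symm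

theorem Ident.trans {a b c : Term} (h : Ident P a b) (h' : Ident P b c) : Ident P a c :=
  fun u A hA => (h u A hA).trans (h' u A hA)

theorem holds_neg {A : Formula} : Holds e P (.neg A) ↔ ¬ Holds e P A := by
  simp [Formula.neg, Holds]

theorem holds_or {A B : Formula} : Holds e P (.or A B) ↔ Holds e P A ∨ Holds e P B := by
  simp only [Formula.or, Holds]; tauto

theorem holds_and {A B : Formula} : Holds e P (.and A B) ↔ Holds e P A ∧ Holds e P B := by
  simp only [Formula.and, Holds]; tauto

theorem holds_imp {A B : Formula} : Holds e P (.imp A B) ↔ (Holds e P A → Holds e P B) := by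
  simp only [Formula.imp, Holds]; tauto

theorem holds_iff {A B : Formula} : Holds e P (.iff A B) ↔ (Holds e P A ↔ Holds e P B) := by
  simp only [Formula.iff, holds_and, holds_imp]; tauto

theorem holds_inst_all {ρ : ℕ → Term} (hρ : IsValuation ρ) {y : ℕ} {A : Formula} :
    Holds e P ((Formula.all y A).inst ρ) ↔
      ∀ a : Term, a.IsCognomen → Holds e P (A.inst (Function.update ρ y a)) := by
  simp only [Formula.inst, Holds, A.subst_inst_update hρ.isPartialValuation]

theorem holds_inst_ex {ρ : ℕ → Term} (hρ : IsValuation ρ) {y : ℕ} {A : Formula} :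
    Holds e P ((Formula.ex y A).inst ρ) ↔
      ∃ a : Term, a.IsCognomen ∧ Holds e P (A.inst (Function.update ρ y a)) := by
  have h : (Formula.ex y A).inst ρ = .neg ((Formula.all y A.neg).inst ρ) := rfl
  rw [h, holds_neg, holds_inst_all hρ]
  have h' : ∀ σ, A.neg.inst σ = (A.inst σ).neg := fun _ => rfl
  simp only [h', holds_neg, not_forall, not_not, exists_prop]

theorem holds_inst_mem_sort {ρ : ℕ → Term} (hρ : IsValuation ρ) {u : ℕ} {A : Formula} {c : Term} :
    Holds e P ((Formula.mem c (.sort u A)).inst ρ) ↔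
      P (A.inst (Function.update ρ u (c.inst ρ))) := by
  simp only [Formula.mem, Formula.inst, Term.inst, Holds, Mem,
    A.subst_inst_update hρ.isPartialValuation]

/-- `𝕋A` expresses at a stage exactly that `A` holds as seen through `P`. -/
theorem holds_inst_truth {ρ : ℕ → Term} (hρ : IsValuation ρ) {A : Formula} :
    Holds e P (A.truth.inst ρ) ↔ P (A.inst ρ) := by
  rw [Formula.truth, holds_inst_ex hρ]
  have key : ∀ a : Term, a.IsCognomen →
      (Holds e P ((Formula.mem (.noema A.fresh) (.sort A.fresh A)).inst
        (Function.update ρ A.fresh a)) ↔ P (A.inst ρ)) := fun a ha => by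
    rw [holds_inst_mem_sort (hρ.update _ ha), Formula.inst_update_of_notMem A.fresh_notMem,
      Formula.inst_update_of_notMem A.fresh_notMem]
  exact ⟨fun ⟨a, ha, h⟩ => (key a ha).1 h, fun h => ⟨_, hρ 0, (key _ (hρ 0)).2 h⟩⟩

theorem holds_inst_eq {ρ : ℕ → Term} (hρ : IsValuation ρ) {r : ℕ} {a b : Term}
    (ha : r ∉ a.noemata) (hb : r ∉ b.noemata) :
    Holds e P ((Formula.eq r a b).inst ρ) ↔ Ident P (a.inst ρ) (b.inst ρ) := by
  have h : (Formula.eq r a b).inst ρ = .eq r (a.inst ρ) (b.inst ρ) := by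
    simp only [Formula.eq, Formula.imp, Formula.mem, Formula.inst, Term.inst,
      Term.inst_update_of_notMem ha, Term.inst_update_of_notMem hb, Function.update_self]
  rw [h, holds_eq_iff e P r (a.isCognomen_inst hρ) (b.isCognomen_inst hρ)]

/-- Identity in the form of a substitution principle: identical cognomina may be exchanged in any
instance of a formula that is seen through `P`. -/
theorem Ident.inst_iff {a b : Term} (h : Ident P a b) (A : Formula) {ρ : ℕ → Term}
    (hρ : IsValuation ρ) (u : ℕ) :
    P (A.inst (Function.update ρ u a)) ↔ P (A.inst (Function.update ρ u b)) := by
  rw [← A.subst_inst_update hρ.isPartialValuation u a,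
    ← A.subst_inst_update hρ.isPartialValuation u b]
  refine h u _ fun n hn => ?_
  have h1 := (A.of_mem_noemata_inst (hρ.isPartialValuation.update u) n hn).2
  by_contra hne
  rw [Function.update_of_ne (by simpa using hne)] at h1
  have h2 := hρ n
  rw [h1] at h2
  simp [Term.IsCognomen, Term.noemata] at h2

theorem isValuation_name (he : IsValuation e) (P : Formula → Prop) : IsValuation (name e P) := by
  intro n
  induction n with
  | zero => simpa [name] using he 0
  | succ n ih =>
    rw [name]
    split_ifs
    · exact he _
    · exact ih

/-- The naming of cognomina by noemata depends on the stage only through identity. -/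
theorem name_congr {Q : Formula → Prop} (he : IsValuation e)
    (h : ∀ a b : Term, a.IsCognomen → b.IsCognomen → (Ident P a b ↔ Ident Q a b)) :
    name e P = name e Q := by
  funext n
  induction n using Nat.strong_induction_on with
  | _ n ih =>
    cases n with
    | zero => simp [name]
    | succ n =>
      rw [name, name, ih n (Nat.lt_succ_self n)]
      have : (∀ m, (_ : m < n + 1) → ¬ Ident P (name e P m) (e (n + 1))) ↔
          ∀ m, (_ : m < n + 1) → ¬ Ident Q (name e Q m) (e (n + 1)) :=
        forall_congr' fun m => forall_congr' fun hm => by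
          rw [ih m hm, h _ _ (isValuation_name he Q m) (he _)]
      by_cases hP : ∀ m, (_ : m < n + 1) → ¬ Ident P (name e P m) (e (n + 1))
      · rw [if_pos hP, if_pos (this.1 hP)]
      · rw [if_neg hP, if_neg (mt this.2 hP)]

end Holds

/-! ### Stages -/

section Stages

variable {e : ℕ → Term}

/-- `B` holds at all stages below `α` from some stage on: the predicate through which stage `α`
sees the earlier stages. -/
def Settled (e : ℕ → Term) (α : Ordinal.{0}) (B : Formula) : Prop :=
  ∃ β, β < α ∧ ∀ γ, β ≤ γ → γ < α → Models e γ B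

theorem models_iff {α : Ordinal.{0}} {A : Formula} :
    Models e α A ↔ Holds e (Settled e α) (A.inst (name e (Settled e α))) := by
  rw [Models]; rfl

theorem models_inst {α : Ordinal.{0}} {A : Formula} {ρ : ℕ → Term} (hρ : IsValuation ρ) :
    Models e α (A.inst ρ) ↔ Holds e (Settled e α) (A.inst ρ) := by
  rw [models_iff, Formula.inst_eq_self (A.noemata_inst hρ)]

theorem models_truth (he : IsValuation e) {α : Ordinal.{0}} {A : Formula} :
    Models e α A.truth ↔ Settled e α (A.inst (name e (Settled e α))) := by
  rw [models_iff, holds_inst_truth (isValuation_name he _)]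

theorem settled_add_one {α : Ordinal.{0}} {A : Formula} :
    Settled e (α + 1) A ↔ Models e α A := by
  constructor
  · rintro ⟨β, hβ, h⟩
    exact h α (Order.lt_add_one_iff.1 hβ) (Order.lt_add_one_iff.2 le_rfl)
  · intro h
    refine ⟨α, Order.lt_add_one_iff.2 le_rfl, fun γ h1 h2 => ?_⟩
    rwa [le_antisymm (Order.lt_add_one_iff.1 h2) h1]

theorem settled_of_forall {η α : Ordinal.{0}} (hα : η < α) {A : Formula}
    (h : ∀ γ, η ≤ γ → Models e γ A) : Settled e α A :=
  ⟨η, hα, fun γ h1 _ => h γ h1⟩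

/-- Formulas that are equivalent from `η` on are settled at the same stages beyond `η`. -/
theorem settled_congr {η α : Ordinal.{0}} (hα : η < α) {A B : Formula}
    (h : ∀ γ, η ≤ γ → (Models e γ A ↔ Models e γ B)) : Settled e α A ↔ Settled e α B := by
  constructor
  · rintro ⟨β, hβ, h'⟩
    exact ⟨max β η, max_lt hβ hα, fun γ h1 h2 =>
      (h γ ((le_max_right _ _).trans h1)).1 (h' γ ((le_max_left _ _).trans h1) h2)⟩
  · rintro ⟨β, hβ, h'⟩
    exact ⟨max β η, max_lt hβ hα, fun γ h1 h2 =>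
      (h γ ((le_max_right _ _).trans h1)).2 (h' γ ((le_max_left _ _).trans h1) h2)⟩

/-! ### Identity becomes final -/

/-- Cognomina that are identical at a stage are identical at all earlier stages: the stage sees
that `b = b`, hence, exchanging `a` and `b`, that `a = b` holds on a final segment of the earlier
stages; descend from the beginning of that segment. -/
theorem Ident.of_le {a b : Term} (ha : a.IsCognomen) (hb : b.IsCognomen) :
    ∀ {α : Ordinal.{0}}, Ident (Settled e α) a b → ∀ β ≤ α, Ident (Settled e β) a b := by
  intro α
  induction α using WellFoundedLT.induction with
  | _ α ih =>
    intro h β hβ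
    rcases hβ.eq_or_lt with rfl | hβ
    · exact h
    -- The formula `v₀ = b`, whose instances at `a` and `b` are exchanged.
    have hinst : ∀ (c : Term), c.IsCognomen → ∀ γ,
        (Models e γ ((Formula.eq 1 (.noema 0) b).inst (Function.update (fun _ => b) 0 c)) ↔
          Ident (Settled e γ) c b) := fun c hc γ => by
      have hv : IsValuation (Function.update (fun _ => b) 0 c) :=
        IsValuation.update (fun _ => hb) 0 hc
      rw [models_inst hv, holds_inst_eq hv (by simp [Term.noemata])
        (by simp [show b.noemata = ∅ from hb]), hb.inst_eq]
      simp [Term.inst]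
    have hset : Settled e α
        ((Formula.eq 1 (.noema 0) b).inst (Function.update (fun _ => b) 0 b)) :=
      ⟨β, hβ, fun γ _ _ => (hinst b hb γ).2 (Ident.refl _ _)⟩
    rw [← h.inst_iff _ (fun _ => hb)] at hset
    obtain ⟨δ, hδ, h'⟩ := hset
    rcases le_or_gt δ β with hle | hlt
    · exact (hinst a ha β).1 (h' β hle hβ)
    · exact ih δ hδ ((hinst a ha δ).1 (h' δ le_rfl hδ)) β hlt.le

/-- Identity at every stage. -/
def AlwaysIdent (e : ℕ → Term) (a b : Term) : Prop := ∀ α, Ident (Settled e α) a b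

theorem AlwaysIdent.refl (a : Term) : AlwaysIdent e a a := fun _ => Ident.refl _ _

theorem AlwaysIdent.symm {a b : Term} (h : AlwaysIdent e a b) : AlwaysIdent e b a :=
  fun α => (h α).symm

theorem AlwaysIdent.trans {a b c : Term} (h : AlwaysIdent e a b) (h' : AlwaysIdent e b c) :
    AlwaysIdent e a c := fun α => (h α).trans (h' α)

/-- Identity does not change any more from stage `η` on. -/
def IdentFinal (e : ℕ → Term) (η : Ordinal.{0}) : Prop :=
  ∀ a b : Term, a.IsCognomen → b.IsCognomen → ∀ γ, η ≤ γ → Ident (Settled e γ) a b →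
    AlwaysIdent e a b

/-- Since identity only decreases along the stages and the pairs of terms form a set, the first
stages at which pairs are distinguished are bounded. -/
theorem exists_identFinal (e : ℕ → Term) : ∃ η, IdentFinal e η := by
  classical
  let f : Term × Term → Ordinal.{0} := fun q =>
    if h : ∃ α, ¬ Ident (Settled e α) q.1 q.2 then h.choose else 0
  refine ⟨⨆ q, f q, fun a b ha hb γ hγ h => ?_⟩
  by_contra hne
  simp only [AlwaysIdent, not_forall] at hne
  have hf : ¬ Ident (Settled e (f (a, b))) a b := by
    simp only [f]
    rw [dif_pos hne]
    exact hne.choose_spec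
  exact hf (Ident.of_le ha hb h _ ((Ordinal.le_iSup f (a, b)).trans hγ))

theorem IdentFinal.ident_iff {η γ : Ordinal.{0}} (hη : IdentFinal e η) (hγ : η ≤ γ) {a b : Term}
    (ha : a.IsCognomen) (hb : b.IsCognomen) :
    Ident (Settled e γ) a b ↔ AlwaysIdent e a b :=
  ⟨hη a b ha hb γ hγ, fun h => h γ⟩

/-- Cognomina that are identical at every stage may be exchanged in a formula evaluated at the
stage itself, because the next stage sees that evaluation. -/
theorem AlwaysIdent.holds_iff {a b : Term} (h : AlwaysIdent e a b) (ha : a.IsCognomen)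
    (hb : b.IsCognomen) (A : Formula) {ρ : ℕ → Term} (hρ : IsValuation ρ) (u : ℕ)
    (γ : Ordinal.{0}) :
    Holds e (Settled e γ) (A.inst (Function.update ρ u a)) ↔
      Holds e (Settled e γ) (A.inst (Function.update ρ u b)) := by
  rw [← models_inst (hρ.update u ha), ← models_inst (hρ.update u hb), ← settled_add_one,
    ← settled_add_one]
  exact (h (γ + 1)).inst_iff A hρ u

theorem AlwaysIdent.mem_iff {a b : Term} (h : AlwaysIdent e a b) (ha : a.IsCognomen)
    (hb : b.IsCognomen) {c : Term} (hc : c.IsCognomen) (γ : Ordinal.{0}) :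
    Mem e (Settled e γ) c a ↔ Mem e (Settled e γ) c b := by
  have := h.holds_iff ha hb (.app (.noema 0) c) (ρ := fun _ => c) (fun _ => hc) 0 γ
  simpa [Formula.inst, Term.inst, Holds, hc.inst_eq] using this

/-! ### Ordered pairs -/

theorem Term.noemata_unorderedPair {s r : ℕ} {a b : Term} (has : s ∉ a.noemata)
    (har : r ∉ a.noemata) (hbs : s ∉ b.noemata) (hbr : r ∉ b.noemata) :
    (Term.unorderedPair s r a b).noemata = a.noemata ∪ b.noemata := by
  ext n
  simp only [Term.unorderedPair, Formula.or, Formula.eq, Formula.imp, Formula.mem, Term.noemata,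
    Formula.noemata, Finset.mem_union, Finset.mem_erase, Finset.mem_singleton]
  grind

theorem Term.noemata_pair {s r : ℕ} {a b : Term} (has : s ∉ a.noemata)
    (har : r ∉ a.noemata) (hbs : s ∉ b.noemata) (hbr : r ∉ b.noemata) :
    (Term.pair s r a b).noemata = a.noemata ∪ b.noemata := by
  have h1 := Term.noemata_unorderedPair has har has har
  have h2 := Term.noemata_unorderedPair has har hbs hbr
  rw [Term.pair, Term.noemata_unorderedPair] <;> grind

theorem Term.inst_unorderedPair {s r : ℕ} (hsr : s ≠ r) {a b : Term} (has : s ∉ a.noemata)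
    (har : r ∉ a.noemata) (hbs : s ∉ b.noemata) (hbr : r ∉ b.noemata) (ρ : ℕ → Term) :
    (Term.unorderedPair s r a b).inst ρ = .unorderedPair s r (a.inst ρ) (b.inst ρ) := by
  simp only [Term.unorderedPair, Formula.or, Formula.eq, Formula.imp, Formula.mem, Term.inst,
    Formula.inst, Term.inst_update_of_notMem has, Term.inst_update_of_notMem har,
    Term.inst_update_of_notMem hbs, Term.inst_update_of_notMem hbr, Function.update_self,
    Function.update_of_ne hsr]

theorem Term.inst_pair {s r : ℕ} (hsr : s ≠ r) {a b : Term} (has : s ∉ a.noemata)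
    (har : r ∉ a.noemata) (hbs : s ∉ b.noemata) (hbr : r ∉ b.noemata) (ρ : ℕ → Term) :
    (Term.pair s r a b).inst ρ = .pair s r (a.inst ρ) (b.inst ρ) := by
  have h1 := Term.noemata_unorderedPair has har has har
  have h2 := Term.noemata_unorderedPair has har hbs hbr
  rw [Term.pair, Term.inst_unorderedPair hsr, Term.inst_unorderedPair hsr has har has har,
    Term.inst_unorderedPair hsr has har hbs hbr, Term.pair] <;> grind

theorem Term.IsCognomen.unorderedPair {s r : ℕ} {a b : Term} (ha : a.IsCognomen)
    (hb : b.IsCognomen) : (Term.unorderedPair s r a b).IsCognomen := by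
  simp only [Term.IsCognomen] at ha hb ⊢
  rw [Term.noemata_unorderedPair] <;> simp [ha, hb]

theorem Term.IsCognomen.pair {s r : ℕ} {a b : Term} (ha : a.IsCognomen)
    (hb : b.IsCognomen) : (Term.pair s r a b).IsCognomen :=
  .unorderedPair (.unorderedPair ha ha) (.unorderedPair ha hb)

/-- The members of `{a, b}` at late stages. As membership in a sort is decided by the earlier
stages, `γ` has to lie strictly beyond `η`. -/
theorem IdentFinal.mem_unorderedPair {η γ : Ordinal.{0}} (hη : IdentFinal e η) (hγ : η < γ)
    {s r : ℕ} (hsr : s ≠ r) {a b c : Term} (ha : a.IsCognomen) (hb : b.IsCognomen)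
    (hc : c.IsCognomen) :
    Mem e (Settled e γ) c (.unorderedPair s r a b) ↔ AlwaysIdent e c a ∨ AlwaysIdent e c b := by
  have hv : IsValuation (Function.update (fun _ => c) s c) := IsValuation.update (fun _ => hc) s hc
  have hbody : ∀ δ, η ≤ δ → (Models e δ ((Formula.or (.eq r (.noema s) a) (.eq r (.noema s) b)).inst
      (Function.update (fun _ => c) s c)) ↔ AlwaysIdent e c a ∨ AlwaysIdent e c b) := by
    intro δ hδ
    have hs : r ∉ (Term.noema s).noemata := by simp [Term.noemata, hsr.symm]
    have har : r ∉ a.noemata := by simp [show a.noemata = ∅ from ha]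
    have hbr : r ∉ b.noemata := by simp [show b.noemata = ∅ from hb]
    rw [models_inst hv]
    have : ∀ (A B : Formula) ρ, (Formula.or A B).inst ρ = .or (A.inst ρ) (B.inst ρ) :=
      fun _ _ _ => rfl
    rw [this, holds_or, holds_inst_eq hv hs har, holds_inst_eq hv hs hbr, ha.inst_eq, hb.inst_eq]
    simp only [Term.inst, Function.update_self]
    rw [hη.ident_iff hδ hc ha, hη.ident_iff hδ hc hb]
  have hmem : Mem e (Settled e γ) c (.unorderedPair s r a b) ↔
      Settled e γ ((Formula.or (.eq r (.noema s) a) (.eq r (.noema s) b)).inst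
        (Function.update (fun _ => c) s c)) := by
    have := holds_inst_mem_sort (e := e) (P := Settled e γ) (ρ := fun _ => c) (fun _ => hc)
      (u := s) (A := .or (.eq r (.noema s) a) (.eq r (.noema s) b)) (c := c)
    rw [hc.inst_eq] at this
    rw [← this]
    have hcl : (Term.unorderedPair s r a b).inst (fun _ => c) = .unorderedPair s r a b :=
      Term.IsCognomen.inst_eq (.unorderedPair ha hb) _
    rw [Term.unorderedPair] at hcl
    simp only [Formula.mem, Formula.inst, Holds, hc.inst_eq, hcl, Term.unorderedPair]
  rw [hmem]
  constructor
  · rintro ⟨β, hβ, h⟩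
    exact (hbody (max β η) (le_max_right _ _)).1 (h _ (le_max_left _ _) (max_lt hβ hγ))
  · exact fun h => ⟨η, hγ, fun δ h1 _ => (hbody δ h1).2 h⟩

/-- Kuratowski pairs are injective up to identity at every stage: the usual argument, read at
stage `η + 1`, where the members of unordered pairs are already the right ones. -/
theorem IdentFinal.pair_injective {η : Ordinal.{0}} (hη : IdentFinal e η) {s r : ℕ} (hsr : s ≠ r)
    {a b c d : Term} (ha : a.IsCognomen) (hb : b.IsCognomen) (hc : c.IsCognomen)
    (hd : d.IsCognomen) (h : AlwaysIdent e (.pair s r a b) (.pair s r c d)) :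
    AlwaysIdent e a c ∧ AlwaysIdent e b d := by
  have hγ : η < η + 1 := Order.lt_add_one_iff.2 le_rfl
  have haa : (Term.unorderedPair s r a a).IsCognomen := .unorderedPair ha ha
  have hab : (Term.unorderedPair s r a b).IsCognomen := .unorderedPair ha hb
  have hcc : (Term.unorderedPair s r c c).IsCognomen := .unorderedPair hc hc
  have hcd : (Term.unorderedPair s r c d).IsCognomen := .unorderedPair hc hd
  have mem_pair : ∀ {u v w : Term}, u.IsCognomen → v.IsCognomen → w.IsCognomen →
      (Mem e (Settled e (η + 1)) w (.unorderedPair s r u v) ↔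
        AlwaysIdent e w u ∨ AlwaysIdent e w v) :=
    fun hu hv hw => hη.mem_unorderedPair hγ hsr hu hv hw
  have trade : ∀ {u v w : Term}, u.IsCognomen → v.IsCognomen → w.IsCognomen →
      AlwaysIdent e u v → Mem e (Settled e (η + 1)) w u → Mem e (Settled e (η + 1)) w v :=
    fun hu hv hw huv => (huv.mem_iff hu hv hw _).1
  have h1 : AlwaysIdent e (.unorderedPair s r a a) (.unorderedPair s r c c) ∨
      AlwaysIdent e (.unorderedPair s r a a) (.unorderedPair s r c d) :=
    (mem_pair hcc hcd haa).1 (trade (.pair ha hb) (.pair hc hd) haa h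
      ((mem_pair haa hab haa).2 (Or.inl (.refl _))))
  have h2 : AlwaysIdent e (.unorderedPair s r a b) (.unorderedPair s r c c) ∨
      AlwaysIdent e (.unorderedPair s r a b) (.unorderedPair s r c d) :=
    (mem_pair hcc hcd hab).1 (trade (.pair ha hb) (.pair hc hd) hab h
      ((mem_pair haa hab hab).2 (Or.inr (.refl _))))
  have h3 : AlwaysIdent e (.unorderedPair s r c d) (.unorderedPair s r a a) ∨
      AlwaysIdent e (.unorderedPair s r c d) (.unorderedPair s r a b) :=
    (mem_pair haa hab hcd).1 (trade (.pair hc hd) (.pair ha hb) hcd h.symm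
      ((mem_pair hcc hcd hcd).2 (Or.inr (.refl _))))
  have hac : AlwaysIdent e c a := by
    rcases h1 with h1 | h1
    · simpa using (mem_pair ha ha hc).1 (trade hcc haa hc h1.symm
        ((mem_pair hc hc hc).2 (Or.inl (.refl _))))
    · simpa using (mem_pair ha ha hc).1 (trade hcd haa hc h1.symm
        ((mem_pair hc hd hc).2 (Or.inl (.refl _))))
  have hb' : AlwaysIdent e b c ∨ AlwaysIdent e b d := by
    rcases h2 with h2 | h2
    · exact Or.inl (by simpa using (mem_pair hc hc hb).1 (trade hab hcc hb h2
        ((mem_pair ha hb hb).2 (Or.inr (.refl _)))))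
    · exact (mem_pair hc hd hb).1 (trade hab hcd hb h2 ((mem_pair ha hb hb).2 (Or.inr (.refl _))))
  have hd' : AlwaysIdent e d a ∨ AlwaysIdent e d b := by
    rcases h3 with h3 | h3
    · exact Or.inl (by simpa using (mem_pair ha ha hd).1 (trade hcd haa hd h3
        ((mem_pair hc hd hd).2 (Or.inr (.refl _)))))
    · exact (mem_pair ha hb hd).1 (trade hcd hab hd h3 ((mem_pair hc hd hd).2 (Or.inr (.refl _))))
  refine ⟨hac.symm, ?_⟩
  rcases hb' with hb' | hb'
  · rcases hd' with hd' | hd'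
    · exact hb'.trans (hac.trans hd'.symm)
    · exact hd'.symm
  · exact hb'

/-- The term `{⟨x, g⟩ | C}`, that is `{p | ∃x ∃g (p = ⟨x, g⟩ ∧ C)}`, with all bound variables
displayed. -/
def Term.pairSort (p x g s r : ℕ) (C : Formula) : Term :=
  .sort p (.ex x (.ex g (.and (.eq r (.noema p) (.pair s r (.noema x) (.noema g))) C)))

/-- The condition that defines `{⟨x, g⟩ | C}`, evaluated at a pair, amounts to `C` with the
components of the pair put for `x` and `g`. -/
theorem IdentFinal.models_exists_eq_pair {η γ : Ordinal.{0}} (hη : IdentFinal e η) (hγ : η ≤ γ)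
    {p x g s r : ℕ} (hpx : p ≠ x) (hpg : p ≠ g) (hxg : x ≠ g) (hsr : s ≠ r) (hxs : x ≠ s)
    (hxr : x ≠ r) (hgs : g ≠ s) (hgr : g ≠ r) (hpr : p ≠ r) {C : Formula} (hp : p ∉ C.noemata)
    {ρ : ℕ → Term} (hρ : IsValuation ρ) {a b : Term} (ha : a.IsCognomen) (hb : b.IsCognomen) :
    Models e γ ((Formula.ex x (.ex g (.and (.eq r (.noema p) (.pair s r (.noema x) (.noema g)))
        C))).inst (Function.update ρ p (.pair s r a b))) ↔
      Models e γ (C.inst (Function.update (Function.update ρ x a) g b)) := by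
  have hpair : (Term.pair s r a b).IsCognomen := .pair ha hb
  have hx' : ∀ n, n ≠ x → n ∉ (Term.noema x).noemata := by simp [Term.noemata]
  have hg' : ∀ n, n ≠ g → n ∉ (Term.noema g).noemata := by simp [Term.noemata]
  have hv := hρ.update p hpair
  rw [models_inst hv, models_inst ((hρ.update x ha).update g hb), holds_inst_ex hv]
  have hC : ∀ c d : Term, C.inst (Function.update (Function.update
      (Function.update ρ p (.pair s r a b)) x c) g d) =
        C.inst (Function.update (Function.update ρ x c) g d) := fun c d => by
    rw [Function.update_comm hpx, Function.update_comm hpg, Formula.inst_update_of_notMem hp]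
  have key : ∀ c d : Term, c.IsCognomen → d.IsCognomen →
      (Holds e (Settled e γ) ((Formula.and (.eq r (.noema p) (.pair s r (.noema x) (.noema g)))
        C).inst (Function.update (Function.update (Function.update ρ p (.pair s r a b)) x c) g d)) ↔
      AlwaysIdent e (.pair s r a b) (.pair s r c d) ∧
        Holds e (Settled e γ) (C.inst (Function.update (Function.update ρ x c) g d))) := by
    intro c d hc hd
    have hv' := (hv.update x hc).update g hd
    have : ∀ (A B : Formula) ρ, (Formula.and A B).inst ρ = .and (A.inst ρ) (B.inst ρ) :=
      fun _ _ _ => rfl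
    rw [this, holds_and, holds_inst_eq hv' (by simp [Term.noemata, hpr.symm]) (by
      rw [Term.noemata_pair (hx' s hxs.symm) (hx' r hxr.symm) (hg' s hgs.symm)
        (hg' r hgr.symm)]
      simp [Term.noemata, hxr.symm, hgr.symm]), hC,
      Term.inst_pair hsr (hx' s hxs.symm) (hx' r hxr.symm) (hg' s hgs.symm) (hg' r hgr.symm)]
    simp only [Term.inst, Function.update_self, Function.update_of_ne hxg,
      Function.update_of_ne hpx, Function.update_of_ne hpg]
    rw [hη.ident_iff hγ hpair (.pair hc hd)]
  constructor
  · rintro ⟨c, hc, h⟩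
    rw [holds_inst_ex (hv.update x hc)] at h
    obtain ⟨d, hd, h⟩ := h
    obtain ⟨h1, h2⟩ := (key c d hc hd).1 h
    obtain ⟨hac, hbd⟩ := hη.pair_injective hsr ha hb hc hd h1
    rw [← hbd.holds_iff hb hd C (hρ.update x hc) g γ, Function.update_comm hxg,
      ← hac.holds_iff ha hc C (hρ.update g hb) x γ, Function.update_comm hxg.symm] at h2
    exact h2
  · intro h
    refine ⟨a, ha, ?_⟩
    rw [holds_inst_ex (hv.update x ha)]
    exact ⟨b, hb, (key a b ha hb).2 ⟨.refl _, h⟩⟩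

end Stages

/-! ### Manifestation points -/

/-- The term `{t | ⟨t, c⟩ ∈ c}`, with the bound variables of the pair displayed. -/
def Term.selfApplication (t s r : ℕ) (c : Term) : Term :=
  .sort t (.mem (.pair s r (.noema t) c) c)

/-- The term `d` of which the manifestation point is the self-application. The new bound variables
are numbered from `N` on. -/
def manifestationBase (N x y : ℕ) (A : Formula) : Term :=
  .pairSort (N + 1) x (N + 2) (N + 3) (N + 4)
    (A.subst y (.selfApplication N (N + 3) (N + 4) (.noema (N + 2))))

theorem manifestationPoint_eq (x y : ℕ) (A : Formula) :
    manifestationPoint x y A =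
      .selfApplication (max A.bound (max (x + 1) (y + 1)))
        (max A.bound (max (x + 1) (y + 1)) + 3) (max A.bound (max (x + 1) (y + 1)) + 4)
        (manifestationBase (max A.bound (max (x + 1) (y + 1))) x y A) := rfl

theorem Term.noemata_selfApplication {t s r : ℕ} (hts : t ≠ s) (htr : t ≠ r) {c : Term}
    (hct : t ∉ c.noemata) (hcs : s ∉ c.noemata) (hcr : r ∉ c.noemata) :
    (Term.selfApplication t s r c).noemata = c.noemata := by
  simp only [Term.selfApplication, Formula.mem, Term.noemata, Formula.noemata]
  rw [Term.noemata_pair (by simp [Term.noemata, hts.symm]) (by simp [Term.noemata, htr.symm])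
    hcs hcr]
  simp only [Term.noemata]
  grind

theorem Term.inst_selfApplication {t s r : ℕ} (hts : t ≠ s) (htr : t ≠ r) (hsr : s ≠ r) {c : Term}
    (hct : t ∉ c.noemata) (hcs : s ∉ c.noemata) (hcr : r ∉ c.noemata) (ρ : ℕ → Term) :
    (Term.selfApplication t s r c).inst ρ = .selfApplication t s r (c.inst ρ) := by
  simp only [Term.selfApplication, Formula.mem, Term.inst, Formula.inst]
  rw [Term.inst_pair hsr (by simp [Term.noemata, hts.symm]) (by simp [Term.noemata, htr.symm])
    hcs hcr, Term.inst_update_of_notMem hct]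
  simp [Term.inst]

theorem Term.noemata_pairSort {p x g s r : ℕ} (hxs : x ≠ s) (hxr : x ≠ r)
    (hgs : g ≠ s) (hgr : g ≠ r) (C : Formula) :
    (Term.pairSort p x g s r C).noemata = C.noemata \ {p, x, g} := by
  have h := Term.noemata_pair (s := s) (r := r) (a := .noema x) (b := .noema g)
    (by simp [Term.noemata, hxs.symm]) (by simp [Term.noemata, hxr.symm])
    (by simp [Term.noemata, hgs.symm]) (by simp [Term.noemata, hgr.symm])
  simp only [Term.pairSort, Formula.ex, Formula.neg, Formula.and, Formula.eq, Formula.imp,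
    Formula.mem, Term.noemata, Formula.noemata, h, Finset.union_self]
  ext n
  simp only [Finset.mem_union, Finset.mem_erase, Finset.mem_singleton, Finset.mem_sdiff,
    Finset.mem_insert]
  grind

theorem noemata_selfApplication_noema (N : ℕ) :
    (Term.selfApplication N (N + 3) (N + 4) (.noema (N + 2))).noemata = {N + 2} := by
  rw [Term.noemata_selfApplication] <;> simp [Term.noemata]

theorem noemata_manifestationBase {N x y : ℕ} {A : Formula} (hA : A.bound ≤ N) (hx : x < N) :
    (manifestationBase N x y A).noemata = A.noemata \ {x, y} := by
  rw [manifestationBase, Term.noemata_pairSort (by omega) (by omega) (by omega) (by omega)]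
  have h1 := A.noemata_subst_subset y (.selfApplication N (N + 3) (N + 4) (.noema (N + 2)))
  have h2 := A.erase_noemata_subset_subst y
    (.selfApplication N (N + 3) (N + 4) (.noema (N + 2)))
  rw [noemata_selfApplication_noema] at h1
  have h3 := A.noemata_lt_bound
  ext n
  simp only [Finset.mem_sdiff, Finset.mem_insert, Finset.mem_singleton]
  constructor
  · rintro ⟨hn, hn'⟩
    have := h1 hn
    grind
  · rintro ⟨hn, hn'⟩
    have := h3 n hn
    have : n ∈ A.noemata.erase y := by grind
    exact ⟨h2 this, by omega⟩

theorem notMem_noemata_manifestationBase {N x y n : ℕ} {A : Formula} (hA : A.bound ≤ N)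
    (hx : x < N) (hn : N ≤ n) : n ∉ (manifestationBase N x y A).noemata := by
  rw [noemata_manifestationBase hA hx]
  intro h
  have := A.noemata_lt_bound n (Finset.mem_sdiff.1 h).1
  omega

theorem noemata_manifestationPoint (x y : ℕ) (A : Formula) :
    (manifestationPoint x y A).noemata = A.noemata \ {x, y} := by
  have hA : A.bound ≤ max A.bound (max (x + 1) (y + 1)) := le_max_left _ _
  have hx : x < max A.bound (max (x + 1) (y + 1)) := by omega
  rw [manifestationPoint_eq, Term.noemata_selfApplication (by omega) (by omega)
    (notMem_noemata_manifestationBase hA hx (by omega))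
    (notMem_noemata_manifestationBase hA hx (by omega))
    (notMem_noemata_manifestationBase hA hx (by omega)), noemata_manifestationBase hA hx]

/-- The equation satisfied by a manifestation point at the late stages. The two nested operators
`𝕋` match the two sorts `h` and `d` which membership in `h` passes through. -/
theorem IdentFinal.holds_mem_manifestationPoint {e : ℕ → Term} {η δ : Ordinal.{0}}
    (hη : IdentFinal e η) (hδ : η + 1 < δ) {x y w : ℕ} {A B : Formula} (hxy : x ≠ y)
    {ρ : ℕ → Term} (hρ : IsValuation ρ)
    (hB : B.inst ρ = A.inst (Function.update (Function.update ρ x (ρ w)) y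
      ((manifestationPoint x y A).inst ρ))) :
    Holds e (Settled e δ) ((Formula.mem (.noema w) (manifestationPoint x y A)).inst ρ) ↔
      Holds e (Settled e δ) (B.truth.truth.inst ρ) := by
  rw [manifestationPoint_eq] at hB ⊢
  have hA : A.bound ≤ max A.bound (max (x + 1) (y + 1)) := le_max_left _ _
  have hx : x < max A.bound (max (x + 1) (y + 1)) := by omega
  have hy : y < max A.bound (max (x + 1) (y + 1)) := by omega
  generalize max A.bound (max (x + 1) (y + 1)) = N at *
  have hbase : ∀ {n}, N ≤ n → n ∉ (manifestationBase N x y A).noemata :=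
    notMem_noemata_manifestationBase hA hx
  rw [Term.inst_selfApplication (by omega) (by omega) (by omega) (hbase (by omega))
    (hbase (by omega)) (hbase (by omega))] at hB
  have hρt := hρ.update N (hρ w)
  have hD := (manifestationBase N x y A).isCognomen_inst hρ
  rw [holds_inst_truth hρ, Term.selfApplication, holds_inst_mem_sort hρ, Term.inst]
  refine settled_congr hδ fun ε hε => ?_
  rw [models_inst hρt, models_inst hρ, holds_inst_truth hρ]
  conv_lhs => rw [manifestationBase.eq_def N x y A]
  rw [Term.pairSort, holds_inst_mem_sort hρt, ← Term.pairSort, ← manifestationBase.eq_def]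
  refine settled_congr (Order.add_one_le_iff.1 hε) fun ζ hζ => ?_
  rw [Term.inst_pair (by omega) (by simp [Term.noemata]) (by simp [Term.noemata])
    (hbase (by omega)) (hbase (by omega)), Term.inst_update_of_notMem (hbase le_rfl)]
  simp only [Term.inst, Function.update_self]
  -- By injectivity of pairs the condition defining `d` holds of `⟨w, d⟩` just in case
  -- `A(w, {t | ⟨t, d⟩ ∈ d})` does, and `{t | ⟨t, d⟩ ∈ d}` is the manifestation point.
  rw [hη.models_exists_eq_pair hζ (by omega) (by omega) (by omega) (by omega) (by omega)
    (by omega) (by omega) (by omega) (by omega) ?_ hρt (hρ w) hD, hB,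
    A.inst_subst y _ (A.substitutable_of_bound_le y _ ?_),
    Term.inst_selfApplication (by omega) (by omega) (by omega) (by simp [Term.noemata])
      (by simp [Term.noemata]) (by simp [Term.noemata])]
  · simp only [Term.inst, Function.update_self]
    rw [Formula.inst_congr A fun n hn => ?_]
    have hn := A.noemata_lt_bound n hn
    by_cases h1 : n = y
    · subst h1; simp
    · by_cases h2 : n = x
      · subst h2; simp [h1, show n ≠ N + 2 by omega]
      · simp [h1, h2, show n ≠ N + 2 by omega, show n ≠ N by omega]
  · rw [noemata_selfApplication_noema]
    simp only [Finset.mem_singleton, forall_eq]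
    omega
  · intro h
    have h1 := A.noemata_subst_subset y _ h
    rw [noemata_selfApplication_noema] at h1
    have h2 := A.noemata_lt_bound (N + 1)
    grind

/-! ### The closure ordinal -/

theorem IdentFinal.mem_stageTruths_iff {e : ℕ → Term} (he : IsValuation e) {η γ : Ordinal.{0}}
    (hη : IdentFinal e η) (hγ : η ≤ γ) {A : Formula} :
    A ∈ stageTruths e γ ↔ Settled e γ (A.inst (name e (Settled e η))) := by
  rw [stageTruths, Set.mem_ofPred_eq, models_truth he, name_congr he fun a b ha hb => ?_]
  rw [hη.ident_iff hγ ha hb, hη.ident_iff le_rfl ha hb]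

/-- A stabilizing ordinal exists: start from a stage by which all stable formulas have settled,
and iterate `ω` times the passage to a stage by which every formula that is not stably in has
failed once more. At the limit no such formula is settled. -/
theorem exists_stabilizes {e : ℕ → Term} (he : IsValuation e) : ∃ σ, Stabilizes e σ := by
  obtain ⟨η, hη⟩ := exists_identFinal e
  have hκ : ∀ A : Formula, ∃ κ : Ordinal.{0},
      (A ∈ stablyIn e → ∀ γ, κ ≤ γ → A ∈ stageTruths e γ) ∧
      (A ∈ stablyOut e → ∀ γ, κ ≤ γ → A ∉ stageTruths e γ) := by
    intro A
    by_cases hin : A ∈ stablyIn e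
    · obtain ⟨β, hβ⟩ := hin
      refine ⟨β, fun _ => hβ, fun ⟨β', hβ'⟩ => ?_⟩
      exact absurd (hβ (max β β') (le_max_left _ _)) (hβ' _ (le_max_right _ _))
    · by_cases hout : A ∈ stablyOut e
      · obtain ⟨β, hβ⟩ := hout
        exact ⟨β, fun h => absurd h hin, fun _ => hβ⟩
      · exact ⟨0, fun h => absurd h hin, fun h => absurd h hout⟩
  choose κ hκin hκout using hκ
  -- A formula that is not stably in fails at arbitrarily late stages.
  have hf : ∀ (A : Formula) (β : Ordinal.{0}), ∃ ζ, A ∉ stablyIn e →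
      β ≤ ζ ∧ ¬ Models e ζ (A.inst (name e (Settled e η))) := by
    intro A β
    by_contra! h
    refine (h 0).1 ⟨max η (β + 1), fun γ hγ => ?_⟩
    rw [hη.mem_stageTruths_iff he ((le_max_left _ _).trans hγ)]
    exact settled_of_forall (Order.add_one_le_iff.1 ((le_max_right _ _).trans hγ))
      fun ζ hζ => (h ζ).2 hζ
  choose f hf using hf
  let F : Ordinal.{0} → Ordinal.{0} := fun β => max β (⨆ A, f A β) + 1
  let seq : ℕ → Ordinal.{0} := fun n => F^[n] (max η (⨆ A, κ A))
  have hseq : ∀ n, seq (n + 1) = F (seq n) := fun n => Function.iterate_succ_apply' F n _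
  have hlt : ∀ n, seq n < ⨆ n, seq n := fun n => by
    refine lt_of_lt_of_le ?_ (Ordinal.le_iSup seq (n + 1))
    rw [hseq]
    exact Order.lt_add_one_iff.2 (le_max_left _ _)
  have hη' : η ≤ ⨆ n, seq n := (le_max_left _ _).trans (hlt 0).le
  have hκ' : ∀ A, κ A ≤ ⨆ n, seq n := fun A =>
    (Ordinal.le_iSup κ A).trans ((le_max_right _ _).trans (hlt 0).le)
  refine ⟨⨆ n, seq n, ⟨?_, fun γ hγ => ⟨fun A hA => ?_, fun A hA => ?_⟩⟩, fun A hA => ?_⟩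
  · refine Ordinal.isSuccLimit_iff.2 ⟨fun h => ?_, fun a ha => ?_⟩
    · have := hlt 0
      rw [h] at this
      exact not_lt_bot this
    · obtain ⟨n, hn⟩ := Ordinal.lt_iSup_iff.1 ha.lt
      exact ha.2 hn (hlt n)
  · exact hκin A hA γ ((hκ' A).trans hγ)
  · by_contra h
    have hout : A ∈ stablyOut e := by
      simp only [unstable, Set.mem_union, Set.mem_compl_iff] at h
      tauto
    exact hκout A hout γ ((hκ' A).trans hγ) hA
  · by_contra hin
    rw [hη.mem_stageTruths_iff he hη'] at hA
    obtain ⟨β, hβ, hA⟩ := hA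
    obtain ⟨n, hn⟩ := Ordinal.lt_iSup_iff.1 hβ
    obtain ⟨h1, h2⟩ := hf A (seq n) hin
    refine h2 (hA _ (hn.le.trans h1) (lt_of_lt_of_le ?_ (Ordinal.le_iSup seq (n + 1))))
    rw [hseq]
    exact Order.lt_add_one_iff.2 ((Ordinal.le_iSup (fun A => f A (seq n)) A).trans
      (le_max_right _ _))

/-- The closure ordinal covers, so whatever is stably true is settled there. -/
theorem isMaxim_of_mem_stablyIn {e : ℕ → Term} (he : IsValuation e) {A : Formula}
    (hA : A ∈ stablyIn e) : IsMaxim e A := by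
  have h : Stabilizes e (koppa e) := csInf_mem (exists_stabilizes he)
  exact (h.1.2 (koppa e) le_rfl).1 hA

end Libra

theorem mainTheorem6 (A : Libra.Formula) (x y z : ℕ) (hxy : x ≠ y) (hxz : x ≠ z) (hyz : y ≠ z)
    (hA : ∀ v ∈ A.noemata, v ≠ x → v ≠ y → A.Substitutable (Libra.Term.noema v) y) :
    ∃ h : Libra.Term,
      h = Libra.manifestationPoint x y A ∧
      h.noemata = A.noemata \ {x, y} ∧
      ∀ w : ℕ, w ∉ A.noemata → w ≠ y → w ≠ z → A.Substitutable (Libra.Term.noema w) x →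
        ∀ e : ℕ → Libra.Term, (∀ n, (e n).IsCognomen) →
          Libra.IsMaxim e (Libra.Formula.all w (Libra.Formula.all z
            (Libra.Formula.iff (Libra.Formula.mem (Libra.Term.noema w) h)
              ((A.subst x (Libra.Term.noema w)).subst y h).truth.truth))) := by
  open Libra in
  refine ⟨manifestationPoint x y A, rfl, noemata_manifestationPoint x y A, ?_⟩
  intro w _ hwy _ hwx e he
  have hsub : A.Substitutable (manifestationPoint x y A) y :=
    A.substitutable_of_forall_noema y _ fun v hv => by
      simp only [noemata_manifestationPoint, Finset.mem_sdiff, Finset.mem_insert,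
        Finset.mem_singleton, not_or] at hv
      exact hA v hv.1 hv.2.1 hv.2.2
  obtain ⟨η, hη⟩ := exists_identFinal e
  -- One step beyond `η` for each of the two sorts that membership in `h` passes through, and one
  -- for the outer `𝕋` in the definition of a stable truth.
  refine isMaxim_of_mem_stablyIn he ⟨η + 1 + 1 + 1, fun γ hγ => ?_⟩
  rw [stageTruths, Set.mem_ofPred_eq, models_truth he]
  refine settled_of_forall (η := η + 1 + 1) (Order.add_one_le_iff.1 hγ) fun δ hδ => ?_
  have hν := isValuation_name he (Settled e γ)
  rw [models_inst hν, holds_inst_all hν]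
  intro a ha
  rw [holds_inst_all (hν.update w ha)]
  intro b hb
  have hρ := (hν.update w ha).update z hb
  generalize Function.update (Function.update (name e (Settled e γ)) w a) z b = ρ at hρ
  have hiff : ∀ B C : Formula, (Formula.iff B C).inst ρ = .iff (B.inst ρ) (C.inst ρ) :=
    fun _ _ => rfl
  rw [hiff, holds_iff]
  refine hη.holds_mem_manifestationPoint (Order.add_one_le_iff.1 hδ) hxy hρ ?_
  rw [Formula.inst_subst y _ _ (Formula.Substitutable.subst hwy A hsub),
    A.inst_subst x _ hwx, Function.update_comm hxy]
  simp only [Term.inst, Function.update_of_ne hwy]
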